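/- Consider the $\mathsf{CONGEST}$ model: the nodes of a network $G=(V,E)$ on $n$ nodes carry distinct identifiers of $O(\log n)$ bits (i.e. natural numbers less than $n^{a}$ for a constant $a$); initially each node knows only its own identifier, the identifiers of its neighbours and a private string of independent fair random bits; in each synchronous round every node performs unrestricted local computation and sends a message of $O(\log n)$ bits to each of its neighbours. An algorithm decides a graph property on a run if every node halts, all nodes output "yes" if $G$ has the property, and at least one node outputs "no" otherwise. Say that $G$ is $H$-free if there is no injective map $\varphi:V(H)\to V(G)$ with $uv\in E(H)\Rightarrow \varphi(u)\varphi(v)\in E(G)$, and induced $H$-free if there is no injective map $\varphi$ with $uv\in E(H)\Leftrightarrow \varphi(u)\varphi(v)\in E(G)$. **Theorem.** Let $H$ be a fixed finite graph. On graphs $G$ of diameter $2$, $H$-freeness and induced $H$-freeness can each be decided in the $\mathsf{CONGEST}$ model in $O(n\log^2 n)$ rounds with high probability. That is, for each of the two properties and for all constants $a,c$ there are a randomized algorithm and constants $B,C$ (depending only on $H,a,c$) such that on every $n$-node graph $G$ of diameter $2$ with distinct identifiers less than $n^a$, all messages have at most $B\log n$ bits, and with probability at least $1-n^{-c}$ all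 nodes halt within $C\,n\log^2 n$ rounds with outputs that correctly decide the property. -/

import Mathlib

open MeasureTheory

universe u

namespace Congest

/-- A synchronous randomized message-passing algorithm, run by every node of the network.
The same algorithm is run on all networks: it is not told the number of nodes.
Local computation is unrestricted. -/
structure Algorithm where
  /-- local states of a node -/
  State : Type
  /-- initial state, from the node's identifier, the set of identifiers of its neighbours and
  its private tape of random bits -/
  init : ℕ → Finset ℕ → (ℕ → Bool) → State
  /-- the message to be sent to the neighbour with the given identifier -/
  send : State → ℕ → List Bool
  /-- the new state, given for each identifier the message received from that neighbour -/
  receive : State → (ℕ → List Bool) → State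
  /-- `none` while the node is running; `some b` once it has halted with output `b` -/
  output : State → Option Bool

variable {V : Type u} [Fintype V]

open Classical in
/-- The identifiers of the neighbours of `v`. -/
noncomputable def neighborIds (G : SimpleGraph V) (ident : V ↪ ℕ) (v : V) : Finset ℕ :=
  (Finset.univ.filter fun u => G.Adj v u).map ident

open Classical in
/-- What the node `v` receives when the nodes are in the states `s`: for the identifier of a
neighbour, the message of that neighbour; otherwise nothing. A halted node sends nothing. -/
noncomputable def Algorithm.inbox (A : Algorithm) (G : SimpleGraph V) (ident : V ↪ ℕ)
    (s : V → A.State) (v : V) : ℕ → List Bool :=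
  Function.extend ident
    (fun u => if G.Adj u v ∧ A.output (s u) = none then A.send (s u) (ident v) else [])
    (fun _ => [])

/-- The states of all nodes after `t` rounds, when `ω v` is the random tape of the node `v`.
A halted node keeps its state, hence its output, forever. -/
noncomputable def Algorithm.run (A : Algorithm) (G : SimpleGraph V) (ident : V ↪ ℕ)
    (ω : V → ℕ → Bool) : ℕ → V → A.State
  | 0 => fun v => A.init (ident v) (neighborIds G ident v) (ω v)
  | t + 1 => fun v =>
      if A.output (A.run G ident ω t v) = none then
        A.receive (A.run G ident ω t v) (A.inbox G ident (A.run G ident ω t) v)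
      else A.run G ident ω t v

/-- Every message ever sent, whatever the random bits, has at most `b` bits. -/
def Algorithm.HasBandwidth (A : Algorithm) (G : SimpleGraph V) (ident : V ↪ ℕ) (b : ℝ) : Prop :=
  ∀ (ω : V → ℕ → Bool) (t : ℕ) (v : V) (i : ℕ),
    ((A.inbox G ident (A.run G ident ω t) v i).length : ℝ) ≤ b

/-- With random tapes `ω`, after `T` rounds all nodes have halted and their outputs decide `p`:
if `p` holds all nodes output yes, otherwise at least one node outputs no. -/
def Algorithm.DecidesBy (A : Algorithm) (G : SimpleGraph V) (ident : V ↪ ℕ) (p : Prop)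
    (T : ℕ) (ω : V → ℕ → Bool) : Prop :=
  (∀ v, A.output (A.run G ident ω T v) ≠ none) ∧
  (p → ∀ v, A.output (A.run G ident ω T v) = some true) ∧
  (¬ p → ∃ v, A.output (A.run G ident ω T v) = some false)

/-- The law of the random tapes: independent fair bits. -/
noncomputable def tapeMeasure (V : Type u) [Fintype V] : Measure (V → ℕ → Bool) :=
  Measure.pi fun _ : V =>
    Measure.infinitePi fun _ : ℕ => (PMF.uniformOfFintype Bool).toMeasure

/-- In the CONGEST model, the graph property `P` can be decided on graphs of diameter 2 in
`O(n log² n)` rounds with high probability. Identifiers are distinct and less than `n ^ a`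
(that is, they have `O(log n)` bits), messages have `O(log n)` bits, and for every `c` the failure
probability can be made at most `1 / n ^ c`. -/
def DecidableOnDiameterTwo (P : ∀ V : Type u, SimpleGraph V → Prop) : Prop :=
  ∀ a c : ℕ, ∃ (A : Algorithm) (B C : ℝ),
    ∀ (V : Type u) [Fintype V] (G : SimpleGraph V) (ident : V ↪ ℕ),
      G.ediam = 2 → (∀ v, ident v < Fintype.card V ^ a) →
      A.HasBandwidth G ident (B * Real.log (Fintype.card V)) ∧
      ∃ T : ℕ, (T : ℝ) ≤ C * (Fintype.card V * Real.log (Fintype.card V) ^ 2) ∧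
        MeasurableSet {ω | A.DecidesBy G ident (P V G) T ω} ∧
        1 - 1 / (Fintype.card V : ℝ) ^ c ≤
          (tapeMeasure V).real {ω | A.DecidesBy G ident (P V G) T ω}

end Congest

/-!
The network is gathered at a node of maximum degree `Δ`, which then decides the property by itself;
no random bits are used. There are at most `n * Δ` edges, and the leader has `Δ` neighbours, so it
is enough that the leader's neighbour of rank `i` reports the `i`-th neighbour of every node, in `n`
rounds. Since the diameter is at most 2, it learns these from its own neighbours in `O(Δ)` rounds.
With a single number as a message, the schedule is:
* rounds `0, 1`: the nodes agree on the largest pair (degree, identifier), hence on `Δ` and on the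
  leader;
* rounds `2 + i`, `i < Δ`: every node announces its `i`-th neighbour;
* round `2 + Δ`: every neighbour of the leader announces its rank among these neighbours;
* rounds `3 + Δ + j`, `j < Δ`: a node tells the leader's neighbour of rank `i` who the `i`-th
  neighbour of its own `j`-th neighbour is;
* rounds `3 + 2 * Δ + j`, `j < n`: the leader's neighbour of rank `i` reports the `i`-th neighbour
  of the `j`-th node.
-/

open scoped Finset

namespace Congest

/-- The number with binary digits `l`, least significant digit first; it decodes `Nat.bits`. -/
def ofBits (l : List Bool) : ℕ := Nat.ofDigits 2 (l.map fun b => cond b 1 0)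

@[simp] lemma ofBits_nil : ofBits [] = 0 := rfl

@[simp] lemma ofBits_bits (n : ℕ) : ofBits n.bits = n := by
  rw [ofBits, ← Nat.digits_two_eq_bits, Nat.ofDigits_digits]

lemma size_le_mul_log {n k m : ℕ} (hn : 2 ≤ n) (hm : m ≤ n ^ k) :
    (m.size : ℝ) ≤ (k + 1) / Real.log 2 * Real.log n := by
  have hlog2 : 0 < Real.log 2 := Real.log_pos one_lt_two
  have hpow : 2 ^ m.size ≤ n ^ (k + 1) := by
    rcases h : m.size with _ | r
    · exact Nat.one_le_pow _ _ (by lia)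
    · have hr : 2 ^ r ≤ m := Nat.lt_size.1 (h ▸ r.lt_succ_self)
      exact Nat.mul_le_mul (hr.trans hm) hn
  have hlog : Real.log (2 ^ m.size) ≤ Real.log (n ^ (k + 1)) :=
    Real.log_le_log (by positivity) (by exact_mod_cast hpow)
  rw [Real.log_pow, Real.log_pow] at hlog
  rw [div_mul_eq_mul_div, le_div_iff₀ hlog2]
  exact_mod_cast hlog

section Entry

variable {S : Finset ℕ} {i x : ℕ}

/-- One more than the `i`-th smallest element of `S`, counted from `0`, or `0` if `S` has at most
`i` elements. -/
noncomputable def entry (S : Finset ℕ) (i : ℕ) : ℕ :=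
  if i < #S then Nat.nth (· ∈ S) i + 1 else 0

/-- The number of elements of `S` less than `x`. -/
def rank (S : Finset ℕ) (x : ℕ) : ℕ := Nat.count (· ∈ S) x

lemma card_toFinset_ofPred_mem (hf : (Set.ofPred (· ∈ S)).Finite) : #hf.toFinset = #S := by
  congr 1
  ext x
  simp

lemma nth_mem (h : i < #S) : Nat.nth (· ∈ S) i ∈ S :=
  Nat.nth_mem (p := (· ∈ S)) i fun hf => h.trans_eq (card_toFinset_ofPred_mem hf).symm

lemma rank_nth (h : i < #S) : rank S (Nat.nth (· ∈ S) i) = i :=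
  Nat.count_nth fun hf => h.trans_eq (card_toFinset_ofPred_mem hf).symm

lemma nth_rank (h : x ∈ S) : Nat.nth (· ∈ S) (rank S x) = x :=
  Nat.nth_count (p := (· ∈ S)) h

lemma rank_le (S : Finset ℕ) (x : ℕ) : rank S x ≤ x := Nat.count_le _

lemma rank_lt_card (h : x ∈ S) : rank S x < #S := by
  have hf : (Set.ofPred (· ∈ S)).Finite := S.finite_toSet
  exact (Nat.count_lt_card hf h).trans_eq (card_toFinset_ofPred_mem hf)

lemma mem_iff_exists_entry {d : ℕ} (hd : #S ≤ d) : x ∈ S ↔ ∃ i < d, entry S i = x + 1 := by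
  constructor
  · intro hx
    exact ⟨rank S x, (rank_lt_card hx).trans_le hd, by simp [entry, rank_lt_card hx, nth_rank hx]⟩
  · rintro ⟨i, -, hi⟩
    by_cases hS : i < #S
    · simp only [entry, hS, if_true, add_left_inj] at hi
      exact hi ▸ nth_mem hS
    · simp [entry, hS] at hi

lemma entry_le {b : ℕ} (h : ∀ x ∈ S, x < b) (i : ℕ) : entry S i ≤ b := by
  unfold entry
  split_ifs with hi
  · exact h _ (nth_mem hi)
  · exact Nat.zero_le _

end Entry

section WithinTwo

variable {V α : Type*} {G : SimpleGraph V}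

/-- Any two nodes are equal, adjacent or have a common neighbour: the diameter is at most 2. -/
def IsWithinTwo (G : SimpleGraph V) : Prop :=
  ∀ u v, u = v ∨ G.Adj u v ∨ ∃ w, G.Adj u w ∧ G.Adj w v

lemma isWithinTwo_of_ediam_le (h : G.ediam ≤ 2) : IsWithinTwo G := by
  intro u v
  have huv : G.edist u v ≤ 2 := SimpleGraph.edist_le_ediam.trans h
  obtain ⟨p, hp⟩ := SimpleGraph.exists_walk_of_edist_ne_top
    (ne_top_of_le_ne_top (by simp) huv)
  have hlen : p.length ≤ 2 := by exact_mod_cast hp.trans_le huv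
  match p, hlen with
  | .nil, _ => exact .inl rfl
  | .cons h .nil, _ => exact .inr (.inl h)
  | .cons h (.cons h' .nil), _ => exact .inr (.inr ⟨_, h, h'⟩)

variable [Fintype V] [SemilatticeSup α] [OrderBot α]

open Classical in
/-- The supremum of `f` over the closed neighbourhood of `v`: what a node knows after one round in
which all nodes send their value of `f`. -/
noncomputable def closedNbhdSup (G : SimpleGraph V) (f : V → α) (v : V) : α :=
  f v ⊔ ({u | G.Adj v u} : Finset V).sup f

lemma le_closedNbhdSup_self (f : V → α) (v : V) : f v ≤ closedNbhdSup G f v := le_sup_left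

lemma le_closedNbhdSup_of_adj (f : V → α) {u v : V} (h : G.Adj v u) :
    f u ≤ closedNbhdSup G f v :=
  le_sup_of_le_right (Finset.le_sup (by simpa using h))

lemma closedNbhdSup_le {f : V → α} {x : α} (h : ∀ u, f u ≤ x) (v : V) :
    closedNbhdSup G f v ≤ x :=
  sup_le (h v) (Finset.sup_le fun u _ => h u)

lemma closedNbhdSup_closedNbhdSup (hG : IsWithinTwo G) {f : V → α} {l : V}
    (hl : ∀ u, f u ≤ f l) (v : V) : closedNbhdSup G (closedNbhdSup G f) v = f l := by
  refine le_antisymm (closedNbhdSup_le (closedNbhdSup_le hl) v) ?_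
  rcases hG v l with rfl | h | ⟨w, hvw, hwl⟩
  · exact (le_closedNbhdSup_self f v).trans (le_closedNbhdSup_self _ v)
  · exact (le_closedNbhdSup_of_adj f h).trans (le_closedNbhdSup_self _ v)
  · exact (le_closedNbhdSup_of_adj f hwl).trans (le_closedNbhdSup_of_adj _ hvw)

end WithinTwo

/-- The state of a node that remembers everything it hears: its identifier, the identifiers of its
neighbours, the number of rounds passed, and the number `heard t i` received from the node `i` in
round `t`. -/
structure View where
  id : ℕ
  nbrs : Finset ℕ
  time : ℕ
  heard : ℕ → ℕ → ℕ

/-- The view after receiving the messages `m`. -/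
def View.receive (s : View) (m : ℕ → List Bool) : View where
  id := s.id
  nbrs := s.nbrs
  time := s.time + 1
  heard := Function.update s.heard s.time fun i => ofBits (m i)

/-- The deterministic algorithm whose messages are numbers, written in binary, where a node with
view `s` sends `msg s u` to the neighbour `u` and has the output `out s`. -/
def viewAlgorithm (msg : View → ℕ → ℕ) (out : View → Option Bool) : Algorithm where
  State := View
  init i N _ := ⟨i, N, 0, fun _ _ => 0⟩
  send s u := (msg s u).bits
  receive := View.receive
  output := out

section NeighborIds

variable {V : Type*} [Fintype V] {G : SimpleGraph V} {ident : V ↪ ℕ} {u v : V} {x : ℕ}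

lemma mem_neighborIds : x ∈ neighborIds G ident v ↔ ∃ u, G.Adj v u ∧ ident u = x := by
  simp [neighborIds]

@[simp] lemma ident_mem_neighborIds : ident u ∈ neighborIds G ident v ↔ G.Adj v u := by
  simp [neighborIds]

lemma card_neighborIds_lt (G : SimpleGraph V) (ident : V ↪ ℕ) (v : V) :
    #(neighborIds G ident v) < Fintype.card V := by
  rw [neighborIds, Finset.card_map]
  exact Finset.card_lt_univ_of_notMem (x := v) (by simp)

end NeighborIds

section Execution

variable {V : Type u} [Fintype V] {G : SimpleGraph V} {ident : V ↪ ℕ} {msg : View → ℕ → ℕ}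
  {out : View → Option Bool}

open Classical in
/-- The views of the nodes after `t` rounds of an algorithm with messages `msg`, when no node ever
halts. -/
noncomputable def view (msg : View → ℕ → ℕ) (G : SimpleGraph V) (ident : V ↪ ℕ) : ℕ → V → View
  | 0 => fun v => ⟨ident v, neighborIds G ident v, 0, fun _ _ => 0⟩
  | t + 1 => fun v => (view msg G ident t v).receive (Function.extend ident
      (fun u => if G.Adj u v then (msg (view msg G ident t u) (ident v)).bits else []) fun _ => [])

lemma run_eq_view {t : ℕ} (ht : ∀ r < t, ∀ v, out (view msg G ident r v) = none)
    (ω : V → ℕ → Bool) : (viewAlgorithm msg out).run G ident ω t = view msg G ident t := by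
  classical
  induction t with
  | zero => rfl
  | succ t ih =>
    have hrun := ih fun r hr => ht r (hr.trans t.lt_succ_self)
    have hout (v : V) : (viewAlgorithm msg out).output (view msg G ident t v) = none :=
      ht t t.lt_succ_self v
    funext v
    refine (if_pos (by rw [hrun]; exact hout v)).trans ?_
    rw [hrun]
    exact congrArg (fun f => (view msg G ident t v).receive (Function.extend ident f fun _ => []))
      (funext fun u => by simp only [hout u, and_true]; rfl)

/-- The family `s` of views, of every node at every time, is that of an execution in which the
messages are `msg` and no node halts. -/
structure IsExecution (msg : View → ℕ → ℕ) (G : SimpleGraph V) (ident : V ↪ ℕ)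
    (s : ℕ → V → View) : Prop where
  id_eq : ∀ t v, (s t v).id = ident v
  nbrs_eq : ∀ t v, (s t v).nbrs = neighborIds G ident v
  time_eq : ∀ t v, (s t v).time = t
  heard_eq : ∀ {r t u v}, r < t → G.Adj v u → (s t v).heard r (ident u) = msg (s r u) (ident v)

lemma isExecution_view : IsExecution msg G ident (view msg G ident) := by
  have time_eq (t : ℕ) (v : V) : (view msg G ident t v).time = t := by
    induction t with
    | zero => rfl
    | succ _ ih => exact congrArg Nat.succ ih
  refine ⟨fun t v => ?_, fun t v => ?_, time_eq, @fun r t u v hr h => ?_⟩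
  · induction t with
    | zero => rfl
    | succ _ ih => exact ih
  · induction t with
    | zero => rfl
    | succ _ ih => exact ih
  · induction t with
    | zero => lia
    | succ t ih =>
      rcases eq_or_ne r t with rfl | hrt
      · simp [view, View.receive, time_eq, ident.injective.extend_apply, h.symm]
      · rw [← ih (by lia)]
        simp [view, View.receive, time_eq, hrt]

end Execution

section Bandwidth

variable {b m : ℕ} {s : View}

/-- All identifiers known to a node and its degree are less than `b`, and all numbers it has
received are at most `m`. -/
structure View.IsBounded (b m : ℕ) (s : View) : Prop where
  id_lt : s.id < b
  nbrs_lt : ∀ x ∈ s.nbrs, x < b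
  card_lt : #s.nbrs < b
  heard_le : ∀ t i, s.heard t i ≤ m

lemma View.IsBounded.receive (h : s.IsBounded b m) {μ : ℕ → List Bool}
    (hμ : ∀ i, ofBits (μ i) ≤ m) : (s.receive μ).IsBounded b m where
  id_lt := h.id_lt
  nbrs_lt := h.nbrs_lt
  card_lt := h.card_lt
  heard_le t i := by
    by_cases ht : t = s.time
    · simp [View.receive, ht, hμ]
    · simp [View.receive, ht, h.heard_le]

variable {V : Type u} {G : SimpleGraph V} {ident : V ↪ ℕ} {msg : View → ℕ → ℕ}
  {out : View → Option Bool}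

lemma exists_le_inbox_eq_bits (hmsg : ∀ s, s.IsBounded b m → ∀ u, msg s u ≤ m) {s : V → View}
    (hs : ∀ v, (s v).IsBounded b m) (v : V) (i : ℕ) :
    ∃ k ≤ m, (viewAlgorithm msg out).inbox G ident s v i = k.bits := by
  unfold Algorithm.inbox
  by_cases hi : ∃ u, ident u = i
  · obtain ⟨u, rfl⟩ := hi
    rw [ident.injective.extend_apply]
    split_ifs
    · exact ⟨_, hmsg _ (hs u) _, rfl⟩
    · exact ⟨0, Nat.zero_le _, by simp⟩
  · exact ⟨0, Nat.zero_le _, by simp [Function.extend_apply' _ _ _ hi]⟩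

variable [Fintype V]

lemma isBounded_run (hmsg : ∀ s, s.IsBounded b m → ∀ u, msg s u ≤ m)
    (hcard : Fintype.card V ≤ b) (hident : ∀ v, ident v < b) (ω : V → ℕ → Bool) (t : ℕ) (v : V) :
    View.IsBounded b m ((viewAlgorithm msg out).run G ident ω t v) := by
  induction t generalizing v with
  | zero =>
    refine ⟨hident v, fun x hx => ?_, (card_neighborIds_lt G ident v).trans_le hcard,
      fun _ _ => Nat.zero_le _⟩
    obtain ⟨u, -, rfl⟩ := mem_neighborIds.1 hx
    exact hident u
  | succ t ih =>
    rw [Algorithm.run]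
    beta_reduce
    split_ifs
    · refine (ih v).receive fun i => ?_
      obtain ⟨k, hk, h⟩ :=
        exists_le_inbox_eq_bits (out := out) (G := G) (ident := ident) hmsg ih v i
      rwa [h, ofBits_bits]
    · exact ih v

lemma hasBandwidth_size (hmsg : ∀ s, s.IsBounded b m → ∀ u, msg s u ≤ m)
    (hcard : Fintype.card V ≤ b) (hident : ∀ v, ident v < b) :
    (viewAlgorithm msg out).HasBandwidth G ident m.size := by
  intro ω t v i
  obtain ⟨k, hk, h⟩ :=
    exists_le_inbox_eq_bits (out := out) hmsg (isBounded_run (G := G) hmsg hcard hident ω t) v i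
  rw [h, Nat.size_eq_bits_len]
  exact_mod_cast Nat.size_le_size hk

end Bandwidth

namespace View

variable (s : View)

/-- The bid of a node for leadership: bids are compared by degree, then by identifier. -/
def bid : ℕ ×ₗ ℕ := toLex (#s.nbrs, s.id)

/-- The maximum of `x` and the bids received in round `t`. -/
def maxHeard (x : ℕ ×ₗ ℕ) (t : ℕ) : ℕ ×ₗ ℕ :=
  x ⊔ s.nbrs.sup fun i => toLex (Nat.unpair (s.heard t i))

/-- The largest bid in the closed neighbourhood. -/
def localBest : ℕ ×ₗ ℕ := s.maxHeard s.bid 0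

/-- The largest bid in the network. -/
def best : ℕ ×ₗ ℕ := s.maxHeard s.localBest 1

/-- The maximum degree. -/
def maxDegree : ℕ := (ofLex s.best).1

/-- The identifier of the leader. -/
def leader : ℕ := (ofLex s.best).2

/-- The neighbours of the neighbour `y`, as announced by `y`. -/
def nbrsOf (y : ℕ) : Finset ℕ :=
  (((Finset.range s.maxDegree).image fun i => s.heard (2 + i) y).erase 0).image Nat.pred

/-- The identifiers of the nodes at distance at most 2. -/
def nodes : Finset ℕ := insert s.id (s.nbrs ∪ s.nbrs.biUnion s.nbrsOf)

/-- The rank of the node among the neighbours of the leader. It is meaningless unless the node is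
one of these. -/
def index : ℕ := rank (s.nbrsOf s.leader) s.id

/-- What the neighbour `u` is told about the `j`-th neighbour: if the index of `u` is `i`, the
`i`-th neighbour of that node. -/
noncomputable def relay (u j : ℕ) : ℕ :=
  entry (s.nbrsOf (Nat.nth (· ∈ s.nbrs) j)) (s.heard (2 + s.maxDegree) u)

/-- For a node of index `i`, the `i`-th neighbour of the node `w`. At distance 2, it is what any
common neighbour has relayed. -/
noncomputable def report (w : ℕ) : ℕ :=
  if w = s.id then entry s.nbrs s.index
  else if w ∈ s.nbrs then entry (s.nbrsOf w) s.index
  else {y ∈ s.nbrs | w ∈ s.nbrsOf y}.sup fun y =>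
    s.heard (3 + s.maxDegree + rank (s.nbrsOf y) w) y

/-- The number to be sent to the neighbour `u`. -/
noncomputable def message (u : ℕ) : ℕ :=
  if s.time = 0 then Nat.pair (#s.nbrs) s.id
  else if s.time = 1 then Nat.pair (ofLex s.localBest).1 (ofLex s.localBest).2
  else if s.time < 2 + s.maxDegree then entry s.nbrs (s.time - 2)
  else if s.time = 2 + s.maxDegree then s.index
  else if s.time < 3 + 2 * s.maxDegree then s.relay u (s.time - (3 + s.maxDegree))
  else s.report (Nat.nth (· ∈ s.nodes) (s.time - (3 + 2 * s.maxDegree)))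

/-- The edges, as reported to the leader. -/
def IsEdge (w x : ℕ) : Prop :=
  ∃ u ∈ s.nbrs, s.heard (3 + 2 * s.maxDegree + rank s.nodes w) u = x + 1

/-- The network, as reported to the leader. -/
def graph : SimpleGraph (ULift.{u} {x // x ∈ s.nodes}) :=
  SimpleGraph.fromRel fun w x => s.IsEdge w.down x.down

/-- All rounds are over. -/
def IsFinal : Prop := s.time = 3 + 2 * s.maxDegree + #s.nodes

open Classical in
/-- The output of a node, where only the leader checks the property `P`. -/
noncomputable def verdict (P : ∀ V : Type u, SimpleGraph V → Prop) : Option Bool :=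
  if s.IsFinal then some (decide (s.leader = s.id → P _ s.graph)) else none

variable {s} {i j u : ℕ}

lemma message_of_time_eq_zero (h : s.time = 0) :
    s.message u = Nat.pair (ofLex s.bid).1 (ofLex s.bid).2 := by
  simp [message, bid, h]

lemma message_of_time_eq_one (h : s.time = 1) :
    s.message u = Nat.pair (ofLex s.localBest).1 (ofLex s.localBest).2 := by
  simp [message, h]

lemma message_eq_entry (h : s.time = 2 + i) (hi : i < s.maxDegree) :
    s.message u = entry s.nbrs i := by
  grind [message]

lemma message_eq_index (h : s.time = 2 + s.maxDegree) : s.message u = s.index := by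
  grind [message]

lemma message_eq_relay (h : s.time = 3 + s.maxDegree + j) (hj : j < s.maxDegree) :
    s.message u = s.relay u j := by
  grind [message]

lemma message_eq_report (h : s.time = 3 + 2 * s.maxDegree + j) :
    s.message u = s.report (Nat.nth (· ∈ s.nodes) j) := by
  grind [message]

lemma mem_nbrsOf {x y : ℕ} : x ∈ s.nbrsOf y ↔ ∃ i < s.maxDegree, s.heard (2 + i) y = x + 1 := by
  simp only [nbrsOf, Finset.mem_image, Finset.mem_erase, Finset.mem_range]
  constructor
  · rintro ⟨_, ⟨h0, i, hi, rfl⟩, rfl⟩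
    exact ⟨i, hi, (Nat.succ_pred h0).symm⟩
  · rintro ⟨i, hi, h⟩
    exact ⟨x + 1, ⟨by simp, i, hi, h⟩, rfl⟩

section Bounded

variable {b m : ℕ}

lemma IsBounded.pair_bid_le (h : s.IsBounded b m) :
    Nat.pair (ofLex s.bid).1 (ofLex s.bid).2 ≤ b ^ 2 :=
  (Nat.pair_lt_max_add_one_sq _ _).le.trans
    (Nat.pow_le_pow_left (Nat.succ_le_of_lt (max_lt h.card_lt h.id_lt)) 2)

lemma IsBounded.pair_maxHeard_le (h : s.IsBounded b m) {x : ℕ ×ₗ ℕ}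
    (hx : Nat.pair (ofLex x).1 (ofLex x).2 ≤ m) (t : ℕ) :
    Nat.pair (ofLex (s.maxHeard x t)).1 (ofLex (s.maxHeard x t)).2 ≤ m := by
  let IsSmall (x : ℕ ×ₗ ℕ) : Prop := Nat.pair (ofLex x).1 (ofLex x).2 ≤ m
  have isSmall_sup (x) (hx : IsSmall x) (y) (hy : IsSmall y) : IsSmall (x ⊔ y) := by
    rcases max_choice x y with h | h <;> rwa [h]
  refine isSmall_sup x hx _ (Finset.sup_induction (Nat.zero_le m) isSmall_sup fun i _ => ?_)
  simpa [IsSmall] using h.heard_le t i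

lemma IsBounded.entry_nbrsOf_le (h : s.IsBounded b m) (y i : ℕ) : entry (s.nbrsOf y) i ≤ m :=
  entry_le (fun x hx => by
    obtain ⟨i, -, hi⟩ := mem_nbrsOf.1 hx
    exact hi.symm.le.trans (h.heard_le _ _)) i

lemma IsBounded.report_le (h : s.IsBounded b m) (hbm : b ≤ m) (w : ℕ) : s.report w ≤ m := by
  unfold report
  split_ifs
  · exact (entry_le h.nbrs_lt _).trans hbm
  · exact h.entry_nbrsOf_le _ _
  · exact Finset.sup_le fun y _ => h.heard_le _ _

lemma IsBounded.message_le (h : s.IsBounded b (b ^ 2)) (u : ℕ) : s.message u ≤ b ^ 2 := by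
  have hb : b ≤ b ^ 2 := Nat.le_self_pow two_ne_zero b
  unfold message
  split_ifs
  · exact h.pair_bid_le
  · exact h.pair_maxHeard_le h.pair_bid_le 0
  · exact (entry_le h.nbrs_lt _).trans hb
  · exact (rank_le _ _).trans (h.id_lt.le.trans hb)
  · exact h.entry_nbrsOf_le _ _
  · exact h.report_le hb _

end Bounded

end View

section Gathering

variable {V : Type u} [Fintype V] {G : SimpleGraph V} {ident : V ↪ ℕ}

/-- The bid for leadership of the node `v`. -/
noncomputable def nodeBid (G : SimpleGraph V) (ident : V ↪ ℕ) (v : V) : ℕ ×ₗ ℕ :=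
  toLex (#(neighborIds G ident v), ident v)

/-- The node `l` has the largest bid, so it has maximum degree. -/
def IsLeader (G : SimpleGraph V) (ident : V ↪ ℕ) (l : V) : Prop :=
  ∀ v, nodeBid G ident v ≤ nodeBid G ident l

lemma exists_isLeader [Nonempty V] (G : SimpleGraph V) (ident : V ↪ ℕ) :
    ∃ l, IsLeader G ident l :=
  Finite.exists_max (nodeBid G ident)

variable {l : V} {s : ℕ → V → View} {t : ℕ}

lemma IsLeader.card_neighborIds_le (hl : IsLeader G ident l) (v : V) :
    #(neighborIds G ident v) ≤ #(neighborIds G ident l) :=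
  Prod.Lex.monotone_fst _ _ (hl v)

namespace IsExecution

variable (hs : IsExecution View.message G ident s)
include hs

lemma bid_eq (t : ℕ) (v : V) : (s t v).bid = nodeBid G ident v := by
  rw [View.bid, nodeBid, hs.nbrs_eq, hs.id_eq]

lemma maxHeard_eq {r : ℕ} {v : V} {f : V → ℕ ×ₗ ℕ}
    (h : ∀ u, G.Adj v u → (s t v).heard r (ident u) = Nat.pair (ofLex (f u)).1 (ofLex (f u)).2) :
    (s t v).maxHeard (f v) r = closedNbhdSup G f v := by
  rw [View.maxHeard, closedNbhdSup, hs.nbrs_eq, neighborIds, Finset.sup_map]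
  congr 1
  refine Finset.sup_congr rfl fun u hu => ?_
  simp [h u (by simpa using hu)]

lemma localBest_eq (ht : 1 ≤ t) (v : V) :
    (s t v).localBest = closedNbhdSup G (nodeBid G ident) v := by
  rw [View.localBest, hs.bid_eq]
  refine hs.maxHeard_eq fun u hu => ?_
  rw [hs.heard_eq ht hu, View.message_of_time_eq_zero (hs.time_eq 0 u), hs.bid_eq]

variable (hG : IsWithinTwo G) (hl : IsLeader G ident l)
include hG hl

lemma best_eq (ht : 2 ≤ t) (v : V) : (s t v).best = nodeBid G ident l := by
  rw [View.best, hs.localBest_eq (by lia), ← closedNbhdSup_closedNbhdSup hG hl v]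
  refine hs.maxHeard_eq fun u hu => ?_
  rw [hs.heard_eq ht hu, View.message_of_time_eq_one (hs.time_eq 1 u), hs.localBest_eq le_rfl]

lemma maxDegree_eq (ht : 2 ≤ t) (v : V) : (s t v).maxDegree = #(neighborIds G ident l) :=
  congrArg (fun x => (ofLex x).1) (hs.best_eq hG hl ht v)

lemma leader_eq (ht : 2 ≤ t) (v : V) : (s t v).leader = ident l :=
  congrArg (fun x => (ofLex x).2) (hs.best_eq hG hl ht v)

lemma nbrsOf_eq (ht : 2 + #(neighborIds G ident l) ≤ t) {v y : V} (hvy : G.Adj v y) :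
    (s t v).nbrsOf (ident y) = neighborIds G ident y := by
  ext x
  rw [View.mem_nbrsOf, hs.maxDegree_eq hG hl (by lia),
    mem_iff_exists_entry (hl.card_neighborIds_le y)]
  refine exists_congr fun i => and_congr_right fun hi => ?_
  rw [hs.heard_eq (by lia) hvy, View.message_eq_entry (hs.time_eq _ y), hs.nbrs_eq]
  rwa [hs.maxDegree_eq hG hl (by lia)]

lemma nodes_eq (ht : 2 + #(neighborIds G ident l) ≤ t) (v : V) :
    (s t v).nodes = Finset.univ.map ident := by
  ext x
  simp only [View.nodes, hs.id_eq, hs.nbrs_eq, Finset.mem_insert, Finset.mem_union,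
    Finset.mem_biUnion, Finset.mem_map, Finset.mem_univ, true_and]
  constructor
  · rintro (rfl | hx | ⟨_, hy, hx⟩)
    · exact ⟨v, rfl⟩
    · obtain ⟨u, -, rfl⟩ := mem_neighborIds.1 hx
      exact ⟨u, rfl⟩
    · obtain ⟨y, hvy, rfl⟩ := mem_neighborIds.1 hy
      rw [hs.nbrsOf_eq hG hl ht hvy] at hx
      obtain ⟨u, -, rfl⟩ := mem_neighborIds.1 hx
      exact ⟨u, rfl⟩
  · rintro ⟨u, rfl⟩
    rcases hG v u with rfl | hvu | ⟨w, hvw, hwu⟩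
    · exact .inl rfl
    · exact .inr (.inl (ident_mem_neighborIds.2 hvu))
    · refine .inr (.inr ⟨ident w, ident_mem_neighborIds.2 hvw, ?_⟩)
      rw [hs.nbrsOf_eq hG hl ht hvw]
      exact ident_mem_neighborIds.2 hwu

lemma index_eq (ht : 2 + #(neighborIds G ident l) ≤ t) {v : V} (hvl : G.Adj v l) :
    (s t v).index = rank (neighborIds G ident l) (ident v) := by
  rw [View.index, hs.leader_eq hG hl (by lia), hs.nbrsOf_eq hG hl ht hvl, hs.id_eq]

lemma heard_index (ht : 3 + #(neighborIds G ident l) ≤ t) {u v : V} (hvu : G.Adj v u)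
    (hul : G.Adj u l) :
    (s t v).heard (2 + #(neighborIds G ident l)) (ident u) =
      rank (neighborIds G ident l) (ident u) := by
  rw [hs.heard_eq (by lia) hvu, View.message_eq_index, hs.index_eq hG hl le_rfl hul]
  rw [hs.time_eq, hs.maxDegree_eq hG hl (by lia)]

lemma relay_eq (ht : 3 + #(neighborIds G ident l) ≤ t) {v y w : V} (hyv : G.Adj y v)
    (hyw : G.Adj y w) (hvl : G.Adj v l) :
    (s t y).relay (ident v) (rank (neighborIds G ident y) (ident w)) =
      entry (neighborIds G ident w) (rank (neighborIds G ident l) (ident v)) := by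
  rw [View.relay, hs.nbrs_eq, nth_rank (ident_mem_neighborIds.2 hyw),
    hs.nbrsOf_eq hG hl (by lia) hyw, hs.maxDegree_eq hG hl (by lia),
    hs.heard_index hG hl ht hyv hvl]

lemma heard_relay (ht : 3 + 2 * #(neighborIds G ident l) ≤ t) {v y w : V} (hvy : G.Adj v y)
    (hyw : G.Adj y w) (hvl : G.Adj v l) :
    (s t v).heard
        (3 + #(neighborIds G ident l) + rank (neighborIds G ident y) (ident w)) (ident y) =
      entry (neighborIds G ident w) (rank (neighborIds G ident l) (ident v)) := by
  have hj : rank (neighborIds G ident y) (ident w) < #(neighborIds G ident l) :=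
    (rank_lt_card (ident_mem_neighborIds.2 hyw)).trans_le (hl.card_neighborIds_le y)
  rw [hs.heard_eq (by lia) hvy, View.message_eq_relay,
    hs.relay_eq hG hl (Nat.le_add_right _ _) hvy.symm hyw hvl]
  · rw [hs.time_eq, hs.maxDegree_eq hG hl (by lia)]
  · rwa [hs.maxDegree_eq hG hl (by lia)]

lemma report_eq (ht : 3 + 2 * #(neighborIds G ident l) ≤ t) {v : V} (hvl : G.Adj v l) (w : V) :
    (s t v).report (ident w) =
      entry (neighborIds G ident w) (rank (neighborIds G ident l) (ident v)) := by
  rw [View.report, hs.index_eq hG hl (by lia) hvl, hs.id_eq, hs.nbrs_eq]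
  split_ifs with hwv hvw
  · rw [ident.injective hwv]
  · rw [hs.nbrsOf_eq hG hl (by lia) (ident_mem_neighborIds.1 hvw)]
  · obtain ⟨y, hvy, hyw⟩ : ∃ y, G.Adj v y ∧ G.Adj y w := by
      rcases hG v w with rfl | h | h
      · exact absurd rfl hwv
      · exact absurd (ident_mem_neighborIds.2 h) hvw
      · exact h
    rw [Finset.sup_congr rfl (g := fun _ =>
      entry (neighborIds G ident w) (rank (neighborIds G ident l) (ident v)))]
    · refine Finset.sup_const ⟨ident y, ?_⟩ _
      rw [Finset.mem_filter, hs.nbrsOf_eq hG hl (by lia) hvy]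
      exact ⟨ident_mem_neighborIds.2 hvy, ident_mem_neighborIds.2 hyw⟩
    · intro z hz
      obtain ⟨hz, hwz⟩ := Finset.mem_filter.1 hz
      obtain ⟨z, hvz, rfl⟩ := mem_neighborIds.1 hz
      rw [hs.nbrsOf_eq hG hl (by lia) hvz] at hwz ⊢
      rw [hs.maxDegree_eq hG hl (by lia)]
      exact hs.heard_relay hG hl ht hvz (ident_mem_neighborIds.1 hwz) hvl

lemma heard_report (ht : 3 + 2 * #(neighborIds G ident l) + Fintype.card V ≤ t) {u : V}
    (hlu : G.Adj l u) (w : V) :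
    (s t l).heard
        (3 + 2 * #(neighborIds G ident l) + rank (Finset.univ.map ident) (ident w)) (ident u) =
      entry (neighborIds G ident w) (rank (neighborIds G ident l) (ident u)) := by
  have hw : ident w ∈ Finset.univ.map ident := by simp
  have hj : rank (Finset.univ.map ident) (ident w) < Fintype.card V := by
    simpa using rank_lt_card hw
  rw [hs.heard_eq (by lia) hlu, View.message_eq_report, hs.nodes_eq hG hl (by lia), nth_rank hw,
    hs.report_eq hG hl (Nat.le_add_right _ _) hlu.symm]
  rw [hs.time_eq, hs.maxDegree_eq hG hl (by lia)]

lemma isEdge_iff (ht : 3 + 2 * #(neighborIds G ident l) + Fintype.card V ≤ t) (w x : V) :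
    (s t l).IsEdge (ident w) (ident x) ↔ G.Adj w x := by
  rw [View.IsEdge, hs.nbrs_eq, hs.maxDegree_eq hG hl (by lia), hs.nodes_eq hG hl (by lia),
    ← ident_mem_neighborIds (ident := ident), mem_iff_exists_entry (hl.card_neighborIds_le w)]
  constructor
  · rintro ⟨_, hu, h⟩
    obtain ⟨u, hlu, rfl⟩ := mem_neighborIds.1 hu
    rw [hs.heard_report hG hl ht hlu] at h
    exact ⟨_, rank_lt_card hu, h⟩
  · rintro ⟨i, hi, h⟩
    obtain ⟨u, hlu, hu⟩ := mem_neighborIds.1 (nth_mem hi)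
    refine ⟨ident u, ident_mem_neighborIds.2 hlu, ?_⟩
    rw [hs.heard_report hG hl ht hlu, hu, rank_nth hi, h]

lemma nonempty_iso_graph (ht : 3 + 2 * #(neighborIds G ident l) + Fintype.card V ≤ t) :
    Nonempty (G ≃g (s t l).graph.{u}) := by
  have mem_nodes (x : ℕ) : x ∈ (s t l).nodes ↔ ∃ v, ident v = x := by
    simp [hs.nodes_eq hG hl (t := t) (by lia)]
  let f (v : V) : ULift.{u} {x // x ∈ (s t l).nodes} := ⟨ident v, (mem_nodes _).2 ⟨v, rfl⟩⟩
  have f_bijective : Function.Bijective f := by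
    refine ⟨fun v w h => ident.injective (congrArg (fun x => x.down.1) h), ?_⟩
    rintro ⟨x, hx⟩
    obtain ⟨v, rfl⟩ := (mem_nodes x).1 hx
    exact ⟨v, rfl⟩
  refine ⟨⟨Equiv.ofBijective f f_bijective, fun {v w} => ?_⟩⟩
  simp only [View.graph, SimpleGraph.fromRel_adj, Equiv.ofBijective_apply, ne_eq,
    f_bijective.1.eq_iff, f, hs.isEdge_iff hG hl ht]
  exact ⟨fun h => h.2.elim _root_.id SimpleGraph.Adj.symm, fun h => ⟨h.ne, .inl h⟩⟩

lemma isFinal_iff (v : V) :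
    (s t v).IsFinal ↔ t = 3 + 2 * #(neighborIds G ident l) + Fintype.card V := by
  have hcard : #(Finset.univ.map ident) = Fintype.card V := by simp
  rw [View.IsFinal, hs.time_eq]
  constructor
  · intro h
    rw [hs.maxDegree_eq hG hl (by lia)] at h
    rwa [hs.nodes_eq hG hl (by lia), hcard] at h
  · intro h
    rwa [hs.maxDegree_eq hG hl (by lia), hs.nodes_eq hG hl (by lia), hcard]

end IsExecution

end Gathering

/-- A graph property that is invariant under isomorphisms. One implication is enough, since
isomorphisms can be inverted. -/
def IsIsoInvariant (P : ∀ V : Type u, SimpleGraph V → Prop) : Prop :=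
  ∀ ⦃V V' : Type u⦄ ⦃G : SimpleGraph V⦄ ⦃G' : SimpleGraph V'⦄, (G ≃g G') → P V G → P V' G'

lemma IsIsoInvariant.iff {P : ∀ V : Type u, SimpleGraph V → Prop} (hP : IsIsoInvariant P)
    {V V' : Type u} {G : SimpleGraph V} {G' : SimpleGraph V'} (e : G ≃g G') : P V G ↔ P V' G' :=
  ⟨hP e, hP e.symm⟩

lemma isIsoInvariant_not_isContained {W : Type*} (H : SimpleGraph W) :
    IsIsoInvariant.{u} fun _ G => ¬ H.IsContained G := by
  intro V V' G G' e hH h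
  exact hH (h.congr_right e)

lemma isIsoInvariant_not_isIndContained {W : Type*} (H : SimpleGraph W) :
    IsIsoInvariant.{u} fun _ G => ¬ H.IsIndContained G := by
  intro V V' G G' e hH h
  exact hH (h.trans e.symm.isIndContained)

section Decision

variable {P : ∀ V : Type u, SimpleGraph V → Prop} {V : Type u} [Fintype V] {G : SimpleGraph V}
  {ident : V ↪ ℕ}

lemma decidesBy_gather (hP : IsIsoInvariant P) (hG : IsWithinTwo G) {l : V}
    (hl : IsLeader G ident l) (ω : V → ℕ → Bool) :
    (viewAlgorithm View.message (View.verdict · P)).DecidesBy G ident (P V G)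
      (3 + 2 * #(neighborIds G ident l) + Fintype.card V) ω := by
  set T := 3 + 2 * #(neighborIds G ident l) + Fintype.card V
  have hs : IsExecution View.message G ident (view View.message G ident) := isExecution_view
  have hrunning (t) (ht : t < T) (v) : (view View.message G ident t v).verdict P = none :=
    if_neg fun h => ht.ne ((hs.isFinal_iff hG hl v).1 h)
  obtain ⟨e⟩ := hs.nonempty_iso_graph hG hl (t := T) le_rfl
  have hverdict (v : V) : (viewAlgorithm View.message (View.verdict · P)).output
      ((viewAlgorithm View.message (View.verdict · P)).run G ident ω T v) =
        some (open Classical in decide (l = v → P V G)) := by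
    rw [run_eq_view hrunning]
    refine (if_pos ((hs.isFinal_iff hG hl v).2 rfl)).trans ?_
    rw [Option.some_inj, decide_eq_decide, hs.leader_eq hG hl (by lia), hs.id_eq,
      ident.injective.eq_iff]
    refine forall_congr' fun h => ?_
    subst h
    exact (hP.iff e).symm
  exact ⟨fun v => by simp [hverdict], fun h v => by simp [hverdict, h],
    fun h => ⟨l, by simp [hverdict, h]⟩⟩

lemma hasBandwidth_gather {a : ℕ} {out : View → Option Bool} (hn : 2 ≤ Fintype.card V)
    (hident : ∀ v, ident v < Fintype.card V ^ a) :
    (viewAlgorithm View.message out).HasBandwidth G ident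
      (((a + 1) * 2 + 1) / Real.log 2 * Real.log (Fintype.card V)) := by
  have hcard : Fintype.card V ≤ Fintype.card V ^ (a + 1) := Nat.le_self_pow a.succ_ne_zero _
  have hpow : Fintype.card V ^ a ≤ Fintype.card V ^ (a + 1) :=
    Nat.pow_le_pow_right (by lia) a.le_succ
  intro ω t v i
  refine (hasBandwidth_size (fun _ hs => hs.message_le) hcard (fun v => (hident v).trans_le hpow)
    ω t v i).trans ?_
  exact_mod_cast size_le_mul_log hn (pow_mul (Fintype.card V) (a + 1) 2).ge

end Decision

/-- A single algorithm, with messages of `O(log n)` bits, decides `P` in `O(n)` rounds, whatever the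
random bits, on all graphs with at least two nodes and of diameter at most 2. -/
def DecidableInLinearTime (P : ∀ V : Type u, SimpleGraph V → Prop) : Prop :=
  ∃ (A : Algorithm) (C : ℕ), ∀ a : ℕ, ∃ B : ℝ,
    ∀ (V : Type u) [Fintype V] [Nontrivial V] (G : SimpleGraph V) (ident : V ↪ ℕ),
      G.ediam ≤ 2 → (∀ v, ident v < Fintype.card V ^ a) →
      A.HasBandwidth G ident (B * Real.log (Fintype.card V)) ∧
      ∃ T ≤ C * Fintype.card V, ∀ ω, A.DecidesBy G ident (P V G) T ω

instance {V : Type u} [Fintype V] : IsProbabilityMeasure (tapeMeasure V) := by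
  unfold tapeMeasure
  infer_instance

lemma DecidableInLinearTime.decidableOnDiameterTwo {P : ∀ V : Type u, SimpleGraph V → Prop}
    (h : DecidableInLinearTime P) : DecidableOnDiameterTwo P := by
  obtain ⟨A, C, hA⟩ := h
  intro a c
  obtain ⟨B, hB⟩ := hA a
  refine ⟨A, B, C / Real.log 2 ^ 2, fun V _ G ident hdiam hident => ?_⟩
  have : Nontrivial V := SimpleGraph.nontrivial_of_ediam_ne_zero (G := G) (by simp [hdiam])
  obtain ⟨hbandwidth, T, hT, hdecides⟩ := hB V G ident hdiam.le hident
  have hlog : Real.log 2 ≤ Real.log (Fintype.card V) :=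
    Real.log_le_log two_pos (by exact_mod_cast Fintype.one_lt_card (α := V))
  refine ⟨hbandwidth, T, ?_, ?_⟩
  · calc (T : ℝ) ≤ C * Fintype.card V := by exact_mod_cast hT
      _ = C / Real.log 2 ^ 2 * (Fintype.card V * Real.log 2 ^ 2) := by field_simp
      _ ≤ C / Real.log 2 ^ 2 * (Fintype.card V * Real.log (Fintype.card V) ^ 2) := by gcongr
  · rw [Set.eq_univ_of_forall (s := {ω | A.DecidesBy G ident (P V G) T ω}) hdecides, probReal_univ]
    exact ⟨MeasurableSet.univ, sub_le_self 1 (by positivity)⟩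

end Congest

open Congest

theorem mainTheorem10_general {P : ∀ V : Type u, SimpleGraph V → Prop} (hP : IsIsoInvariant P) :
    DecidableInLinearTime P := by
  refine ⟨viewAlgorithm View.message (View.verdict · P), 4, fun a =>
    ⟨((a + 1) * 2 + 1) / Real.log 2, fun V _ _ G ident hdiam hident =>
      ⟨hasBandwidth_gather Fintype.one_lt_card hident, ?_⟩⟩⟩
  obtain ⟨l, hl⟩ := exists_isLeader G ident
  refine ⟨3 + 2 * #(neighborIds G ident l) + Fintype.card V, ?_,
    decidesBy_gather hP (isWithinTwo_of_ediam_le hdiam) hl⟩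
  have := card_neighborIds_lt G ident l
  lia

theorem mainTheorem10 {W : Type*} [Finite W] (H : SimpleGraph W) :
    Congest.DecidableOnDiameterTwo.{u} (fun _ G => ¬ H.IsContained G) ∧
    Congest.DecidableOnDiameterTwo.{u} (fun _ G => ¬ H.IsIndContained G) :=
  ⟨(mainTheorem10_general (isIsoInvariant_not_isContained H)).decidableOnDiameterTwo,
    (mainTheorem10_general (isIsoInvariant_not_isIndContained H)).decidableOnDiameterTwo⟩
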